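/- Let $N\ge 3$. For an open set $\Omega\subset\mathbb{R}^N$ let $H^1_0(\Omega)$ be the closure of $C_c^\infty(\Omega)$ in the Sobolev space $H^1(\Omega)$ of real-valued functions, and let $$\mu(\Omega):=\inf\left\{\frac{\int_\Omega|\nabla u|^2\,dx}{\int_\Omega u^2/|x|^2\,dx}\ :\ u\in H^1_0(\Omega),\ u\neq 0\right\}$$ be the optimal constant in the Hardy inequality on $\Omega$ with singularity at the origin. For $0<\gamma<\pi$ let $\mathcal{C}_\gamma\subset\mathbb{R}^N$ be the open cone with vertex $0$ and slot $\gamma$, that is, the set of all $x=(x_1,\dots,x_N)\neq 0$ whose angle $\theta_1\in[0,\pi]$ with the positive $x_N$-axis (so that $x_N=|x|\cos\theta_1$) is smaller than $\gamma$; in particular $\mathcal{C}_{\pi/2}$ is the half-space $\{x_N>0\}$. Then $$\lim_{\gamma\to\pi/2}\mu(\mathcal{C}_\gamma)=\mu(\mathcal{C}_{\pi/2})=\frac{N^2}{4}.$$ -/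

import Mathlib

open MeasureTheory Filter Topology TopologicalSpace
open scoped ENNReal Gradient Distributions

/-- The unit vector `e_N = (0, …, 0, 1)` of `ℝ^N`, along the last coordinate axis. -/
def lastAxis (N : ℕ) : EuclideanSpace ℝ (Fin N) :=
  WithLp.toLp 2 fun i => if (i : ℕ) + 1 = N then 1 else 0

/-- The open cone with slot `γ`: all nonzero `x ∈ ℝ^N` whose polar angle `θ₁`, the angle in
`[0, π]` between `x` and the positive `x_N`-axis (so `x_N = ‖x‖ cos θ₁`), is smaller than `γ`. -/
def cone (N : ℕ) (γ : ℝ) : Opens (EuclideanSpace ℝ (Fin N)) where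
  carrier := {x | x ≠ 0 ∧ InnerProductGeometry.angle x (lastAxis N) < γ}
  is_open' := by
    have hc : ContinuousOn (fun x => InnerProductGeometry.angle x (lastAxis N))
        {x : EuclideanSpace ℝ (Fin N) | x ≠ 0} := by
      intro x hx
      by_cases h : lastAxis N = 0
      · simpa [h, InnerProductGeometry.angle_zero_right] using
          (continuousWithinAt_const : ContinuousWithinAt (fun _ => Real.pi / 2) _ x)
      · have h1 := InnerProductGeometry.continuousAt_angle (x := (x, lastAxis N)) hx h
        have h2 : ContinuousAt (fun y : EuclideanSpace ℝ (Fin N) => (y, lastAxis N)) x := by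
          fun_prop
        exact (ContinuousAt.comp (f := fun y => (y, lastAxis N)) h1 h2).continuousWithinAt
    exact hc.isOpen_inter_preimage isOpen_ne isOpen_Iio

section Sobolev

variable {N : ℕ}

/-- `g` is the weak gradient of `u` on the open set `Ω`:
`∫_Ω u ∂_v φ = - ∫_Ω ⟨g, v⟩ φ` for all test functions `φ` on `Ω` and all directions `v`. -/
def HasWeakGradient (Ω : Opens (EuclideanSpace ℝ (Fin N)))
    (u : EuclideanSpace ℝ (Fin N) → ℝ)
    (g : EuclideanSpace ℝ (Fin N) → EuclideanSpace ℝ (Fin N)) : Prop :=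
  LocallyIntegrableOn u Ω volume ∧ LocallyIntegrableOn g Ω volume ∧
    ∀ (φ : 𝓓(Ω, ℝ)) (v : EuclideanSpace ℝ (Fin N)),
      ∫ x in Ω, u x * fderiv ℝ φ x v = -∫ x in Ω, inner ℝ (g x) v * φ x

/-- `u ∈ H¹(Ω)`, with weak gradient `g`. -/
def MemH1 (Ω : Opens (EuclideanSpace ℝ (Fin N)))
    (u : EuclideanSpace ℝ (Fin N) → ℝ)
    (g : EuclideanSpace ℝ (Fin N) → EuclideanSpace ℝ (Fin N)) : Prop :=
  MemLp u 2 (volume.restrict Ω) ∧ MemLp g 2 (volume.restrict Ω) ∧ HasWeakGradient Ω u g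

/-- `u ∈ H¹₀(Ω)`, with weak gradient `g`: the function `u` lies in the closure of `C_c^∞(Ω)` in
`H¹(Ω)`. -/
def MemH10 (Ω : Opens (EuclideanSpace ℝ (Fin N)))
    (u : EuclideanSpace ℝ (Fin N) → ℝ)
    (g : EuclideanSpace ℝ (Fin N) → EuclideanSpace ℝ (Fin N)) : Prop :=
  MemH1 Ω u g ∧ ∃ φ : ℕ → 𝓓(Ω, ℝ),
    Tendsto (fun n => eLpNorm (fun x => φ n x - u x) 2 (volume.restrict Ω)) atTop (𝓝 0) ∧
    Tendsto (fun n => eLpNorm (fun x => ∇ (φ n) x - g x) 2 (volume.restrict Ω)) atTop (𝓝 0)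

/-- The optimal Hardy constant of `Ω`, as an element of `[0, ∞]`: the infimum of
`∫_Ω |∇u|² / ∫_Ω u²/|x|²` over all `u ∈ H¹₀(Ω)`, `u ≠ 0`. -/
noncomputable def hardyConstant (Ω : Opens (EuclideanSpace ℝ (Fin N))) : ℝ≥0∞ :=
  sInf {q | ∃ u g, MemH10 Ω u g ∧ ¬ u =ᵐ[volume.restrict Ω] 0 ∧
    q = (∫⁻ x in Ω, ‖g x‖ₑ ^ 2) / ∫⁻ x in Ω, ‖u x‖ₑ ^ 2 / ‖x‖ₑ ^ 2}

end Sobolev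

/-! ### Products with singular coefficients and vanishing divergence integrals -/

section Calculus

variable {E : Type*} [NormedAddCommGroup E] [NormedSpace ℝ E]

/-! Everything rests on a ground-state identity. Write `y = ⟪e, x⟫`, `r = ‖x‖`, `w = r ^ (-(N - 2) /
2) (y / r + ε) ^ a`, `F = -∇ log w` and `V = -Δw / w`. Since `div F = V + |F|²`, integrating `div
(φ² F)` for a test function `φ` supported where `w > 0` gives `∫ |∇φ|² = ∫ V φ² + ∫ |∇φ + φ F|²`,
the last integrand being `|w ∇(φ / w)|²` (`integral_norm_gradient_sq`).

Lower bound: take `a = 1 - ε`. Then `r² V ≥ N² / 4 - 3 N² ε` on `y > -ε r`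
(`hardy_numerator_bound`). Dropping the square gives Hardy's inequality for test functions there,
and `le_hardyConstant` carries it to `H¹₀`. The cone of slot `γ ≤ π` lies in this region once `-ε ≤
cos γ`, so `ε` can tend to `0` with `γ → π / 2`.

Upper bound: take `ε = 0`, `a = 1 + k` with `k > 0`, and `φ = w q ^ k τ(j q - 1)`, where `q = y / (1
+ r²)` and `τ` is a smooth step. The exponent `1 + k` gives `V` the negative term `-k (1 + k) / y²`,
which for large `j` outweighs the square term, and the Hardy quotient falls below `N² / 4 + N k +
k²` (`exists_near_optimal`). The support is compact in the open half-space, hence lies in every cone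
with `γ` near `π / 2`; so one function bounds all these constants from above. -/

theorem contDiff_mul_of_tsupport_subset {n : WithTop ℕ∞} {f g : E → ℝ} {U : Set E}
    (hf : ContDiff ℝ n f) (hU : IsOpen U) (hs : tsupport f ⊆ U) (hg : ContDiffOn ℝ n g U) :
    ContDiff ℝ n (fun x => f x * g x) := by
  rw [contDiff_iff_contDiffAt]
  intro x
  by_cases hx : x ∈ tsupport f
  · exact hf.contDiffAt.mul (hg.contDiffAt (hU.mem_nhds (hs hx)))
  · rw [notMem_tsupport_iff_eventuallyEq] at hx
    refine (contDiffAt_const (c := (0 : ℝ))).congr_of_eventuallyEq ?_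
    filter_upwards [hx] with y hy
    simp [hy]

theorem continuous_mul_of_tsupport_subset {f g : E → ℝ} {U : Set E}
    (hf : Continuous f) (hU : IsOpen U) (hs : tsupport f ⊆ U) (hg : ContinuousOn g U) :
    Continuous (fun x => f x * g x) := by
  rw [← contDiff_zero (𝕜 := ℝ)] at hf ⊢
  exact contDiff_mul_of_tsupport_subset hf hU hs (contDiffOn_zero.2 hg)

variable [MeasurableSpace E] [BorelSpace E]
  (μ : Measure E) [μ.IsAddHaarMeasure]

theorem integrable_fderiv_apply {h : E → ℝ} (hh : ContDiff ℝ 1 h) (hc : HasCompactSupport h)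
    {w : E → E} (hw : Continuous w) : Integrable (fun x => fderiv ℝ h x (w x)) μ := by
  have h1 : Continuous (fun x => fderiv ℝ h x (w x)) :=
    (hh.continuous_fderiv one_ne_zero).clm_apply hw
  refine h1.integrable_of_hasCompactSupport ?_
  exact (hc.fderiv (𝕜 := ℝ)).mono fun x hx => by
    contrapose! hx
    simp only [Function.mem_support, not_not] at hx
    simp [hx]

theorem integral_fderiv_apply_eq_zero [FiniteDimensional ℝ E] {h : E → ℝ} (hh : ContDiff ℝ 1 h)
    (hc : HasCompactSupport h) (v : E) : ∫ x, fderiv ℝ h x v ∂μ = 0 := by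
  have := integral_mul_fderiv_eq_neg_fderiv_mul_of_integrable (μ := μ) (𝕜 := ℝ)
    (f := fun _ : E => (1 : ℝ)) (g := h) (v := v) (by simp)
    (by simpa using integrable_fderiv_apply μ hh hc continuous_const)
    (by simpa using hh.continuous.integrable_of_hasCompactSupport hc)
    (by intro x _; fun_prop) (fun x _ => hh.differentiable one_ne_zero x)
  simpa using this

end Calculus

/-! ### Radial fields and the derivative of the norm -/

section Euclidean

variable {N : ℕ}

local notation "E" => EuclideanSpace ℝ (Fin N)

/-- The divergence of the radial field `h(x) x` has vanishing integral. -/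
theorem integral_fderiv_apply_self {h : E → ℝ} (hh : ContDiff ℝ 1 h)
    (hc : HasCompactSupport h) : ∫ x, ((N : ℝ) * h x + fderiv ℝ h x x) = 0 := by
  have hi : ∀ i : Fin N, ∫ x : E, fderiv ℝ (fun x : E => x i * h x) x
      (EuclideanSpace.single i 1) = 0 := fun i =>
    integral_fderiv_apply_eq_zero volume (ContDiff.mul (by fun_prop) hh) hc.mul_left _
  have hpt : ∀ x : E, (N : ℝ) * h x + fderiv ℝ h x x =
      ∑ i : Fin N, fderiv ℝ (fun x : E => x i * h x) x (EuclideanSpace.single i 1) := by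
    intro x
    have h1 : ∀ i : Fin N, fderiv ℝ (fun x : E => x i * h x) x (EuclideanSpace.single i 1)
        = h x + x i * fderiv ℝ h x (EuclideanSpace.single i 1) := by
      intro i
      have hp : HasFDerivAt (fun x : E => x i) (EuclideanSpace.proj i : E →L[ℝ] ℝ) x :=
        (EuclideanSpace.proj i : E →L[ℝ] ℝ).hasFDerivAt
      rw [(hp.fun_mul (hh.differentiable one_ne_zero x).hasFDerivAt).fderiv]
      simp; ring
    simp only [h1, Finset.sum_add_distrib]
    have h2 : x = ∑ i, x i • EuclideanSpace.single i (1 : ℝ) := by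
      ext j
      simp [Finset.sum_apply, Pi.single_apply]
    conv_lhs => rw [h2, map_sum, ← h2]
    simp
  simp only [hpt]
  rw [integral_finsetSum _ fun i _ => integrable_fderiv_apply volume
    (ContDiff.mul (by fun_prop) hh) hc.mul_left continuous_const]
  simp [hi]

theorem hasFDerivAt_norm_of_ne_zero {x : E} (hx : x ≠ 0) :
    HasFDerivAt (fun x : E => ‖x‖) (‖x‖⁻¹ • innerSL ℝ x) x := by
  have h := (hasStrictFDerivAt_norm_sq x).hasFDerivAt.sqrt (by positivity)
  simp only [Real.sqrt_sq (norm_nonneg _)] at h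
  refine h.congr_fderiv ?_
  ext v
  simp
  field_simp

end Euclidean

/-! ### The ground-state identity -/

section HardyField

variable {N : ℕ}

local notation "E" => EuclideanSpace ℝ (Fin N)

/-- The region `⟪e, x⟫ > -ε ‖x‖`, a cone around the axis `e`. -/
def openCone (e : E) (ε : ℝ) : Set E := {x | 0 < inner ℝ e x + ε * ‖x‖}

theorem isOpen_openCone (e : E) (ε : ℝ) : IsOpen (openCone e ε) :=
  isOpen_lt continuous_const (by fun_prop)

theorem ne_zero_of_mem_openCone {e : E} {ε : ℝ} {x : E} (hx : x ∈ openCone e ε) : x ≠ 0 := by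
  rintro rfl
  simp [openCone] at hx

/-- The component along `e` of `-∇ log w`, where
`w = ‖x‖ ^ (-(N - 2) / 2) (⟪e, x⟫ / ‖x‖ + ε) ^ a`. -/
noncomputable def axisCoeff (e : E) (a ε : ℝ) (x : E) : ℝ := -a * (inner ℝ e x + ε * ‖x‖)⁻¹

/-- The coefficient of `x` in `-∇ log w`, where
`w = ‖x‖ ^ (-(N - 2) / 2) (⟪e, x⟫ / ‖x‖ + ε) ^ a`. -/
noncomputable def radialCoeff (e : E) (a ε : ℝ) (x : E) : ℝ :=
  (((N : ℝ) - 2) / 2 + a * inner ℝ e x * (inner ℝ e x + ε * ‖x‖)⁻¹) * (‖x‖ ^ 2)⁻¹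

/-- The field `-∇ log w`. -/
noncomputable def hardyField (e : E) (a ε : ℝ) (x : E) : E :=
  axisCoeff e a ε x • e + radialCoeff e a ε x • x

/-- The potential `-Δ w / w`. -/
noncomputable def hardyPotential (e : E) (a ε : ℝ) (x : E) : ℝ :=
  (((N : ℝ) - 2) ^ 2 / 4
    + a * (1 - a) * (‖x‖ ^ 2 - (inner ℝ e x : ℝ) ^ 2) * ((inner ℝ e x + ε * ‖x‖) ^ 2)⁻¹
    + ((N : ℝ) - 1) * a * inner ℝ e x * (inner ℝ e x + ε * ‖x‖)⁻¹) * (‖x‖ ^ 2)⁻¹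

theorem contDiffOn_axisCoeff (e : E) (a ε : ℝ) :
    ContDiffOn ℝ 1 (axisCoeff e a ε) (openCone e ε) := by
  intro x hx
  have hx0 := ne_zero_of_mem_openCone hx
  have hn : ContDiffAt ℝ 1 (fun x : E => ‖x‖) x := contDiffAt_norm ℝ hx0
  refine ContDiffAt.contDiffWithinAt ?_
  unfold axisCoeff
  refine contDiffAt_const.mul (ContDiffAt.inv ?_ (ne_of_gt hx))
  exact (contDiffAt_const.inner ℝ contDiffAt_id).add (contDiffAt_const.mul hn)

theorem contDiffOn_radialCoeff (e : E) (a ε : ℝ) :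
    ContDiffOn ℝ 1 (radialCoeff e a ε) (openCone e ε) := by
  intro x hx
  have hx0 := ne_zero_of_mem_openCone hx
  have hn : ContDiffAt ℝ 1 (fun x : E => ‖x‖) x := contDiffAt_norm ℝ hx0
  have hi : ContDiffAt ℝ 1 (fun x : E => (inner ℝ e x : ℝ)) x :=
    contDiffAt_const.inner ℝ contDiffAt_id
  refine ContDiffAt.contDiffWithinAt ?_
  unfold radialCoeff
  refine ((contDiffAt_const.add ((contDiffAt_const.mul hi).mul
    (ContDiffAt.inv ?_ (ne_of_gt hx))))).mul ((hn.pow 2).inv (by positivity))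
  exact hi.add (contDiffAt_const.mul hn)

theorem continuousOn_hardyPotential (e : E) (a ε : ℝ) :
    ContinuousOn (hardyPotential e a ε) (openCone e ε) := by
  unfold hardyPotential
  have h1 : ∀ x ∈ openCone e ε, inner ℝ e x + ε * ‖x‖ ≠ 0 := fun x hx => ne_of_gt hx
  have h2 : ∀ x ∈ openCone e ε, ‖x‖ ^ 2 ≠ 0 := fun x hx => by
    have := ne_zero_of_mem_openCone hx
    positivity
  have h3 : ∀ x ∈ openCone e ε, (inner ℝ e x + ε * ‖x‖) ^ 2 ≠ 0 :=
    fun x hx => pow_ne_zero 2 (h1 x hx)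
  fun_prop (disch := assumption)

variable {e : EuclideanSpace ℝ (Fin N)} {a ε : ℝ}

theorem fderiv_axisCoeff_axis (he : ‖e‖ = 1) {x : E} (hx : x ∈ openCone e ε) :
    fderiv ℝ (axisCoeff e a ε) x e =
      a * (1 + ε * (inner ℝ e x : ℝ) / ‖x‖) * ((inner ℝ e x + ε * ‖x‖) ^ 2)⁻¹ := by
  have hx0 := ne_zero_of_mem_openCone hx
  have hx' : inner ℝ e x + ε * ‖x‖ ≠ 0 := ne_of_gt hx
  have hD : HasFDerivAt (fun x : E => (inner ℝ e x + ε * ‖x‖ : ℝ))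
      (innerSL ℝ e + ε • ‖x‖⁻¹ • innerSL ℝ x) x :=
    (innerSL ℝ e).hasFDerivAt.add ((hasFDerivAt_norm_of_ne_zero hx0).const_mul ε)
  have hA := (((hasDerivAt_inv hx').comp_hasFDerivAt x hD).const_mul (-a))
  have : axisCoeff e a ε = fun y => -a * ((fun y => y⁻¹) ∘ fun x : E =>
      (inner ℝ e x + ε * ‖x‖ : ℝ)) y := rfl
  rw [this, hA.fderiv]
  simp [he, real_inner_comm]
  field_simp

/-- Euler's relation: the coefficient is homogeneous of degree `-2`. -/
theorem fderiv_radialCoeff_self {x : E} (hx : x ∈ openCone e ε) :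
    fderiv ℝ (radialCoeff e a ε) x x = -2 * radialCoeff e a ε x := by
  have hx0 := ne_zero_of_mem_openCone hx
  have hx' : inner ℝ e x + ε * ‖x‖ ≠ 0 := ne_of_gt hx
  have hr : ‖x‖ ^ 2 ≠ 0 := by positivity
  have hI : HasFDerivAt (fun x : E => (inner ℝ e x : ℝ)) (innerSL ℝ e) x :=
    (innerSL ℝ e).hasFDerivAt
  have hD : HasFDerivAt (fun x : E => (inner ℝ e x + ε * ‖x‖ : ℝ))
      (innerSL ℝ e + ε • ‖x‖⁻¹ • innerSL ℝ x) x :=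
    hI.add ((hasFDerivAt_norm_of_ne_zero hx0).const_mul ε)
  have hA := ((hI.const_mul a).mul ((hasDerivAt_inv hx').comp_hasFDerivAt x hD)).const_add
    (((N : ℝ) - 2) / 2)
  have hB := hA.mul ((hasDerivAt_inv hr).comp_hasFDerivAt x
    (hasStrictFDerivAt_norm_sq x).hasFDerivAt)
  refine (congrArg (fun T : E →L[ℝ] ℝ => T x) hB.fderiv).trans ?_
  simp [radialCoeff]
  field_simp
  ring

/-- The left side is `div (φ² F)`, split along the two components of `F`. It equals `φ² div F + 2 φ
⟪∇φ, F⟫`; insert `div F = V + |F|²` and complete the square. -/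
theorem divergence_identity (he : ‖e‖ = 1) {φ : E → ℝ} (hφ : ContDiff ℝ 1 φ) {x : E}
    (hx : x ∈ openCone e ε) :
    fderiv ℝ (fun x => φ x ^ 2 * axisCoeff e a ε x) x e +
      ((N : ℝ) * (φ x ^ 2 * radialCoeff e a ε x) +
        fderiv ℝ (fun x => φ x ^ 2 * radialCoeff e a ε x) x x) =
      hardyPotential e a ε x * φ x ^ 2 + ‖∇ φ x + φ x • hardyField e a ε x‖ ^ 2
        - ‖∇ φ x‖ ^ 2 := by
  have hx0 := ne_zero_of_mem_openCone hx
  have hx' : inner ℝ e x + ε * ‖x‖ ≠ 0 := ne_of_gt hx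
  have hr : ‖x‖ ≠ 0 := by positivity
  have hU := (isOpen_openCone e ε).mem_nhds hx
  have hd := (hφ.differentiable one_ne_zero x).hasFDerivAt
  have hd2 : HasFDerivAt (fun x => φ x ^ 2) _ x := hd.pow 2
  have hA := (((contDiffOn_axisCoeff e a ε).contDiffAt hU).differentiableAt
    one_ne_zero).hasFDerivAt
  have hB := (((contDiffOn_radialCoeff e a ε).contDiffAt hU).differentiableAt
    one_ne_zero).hasFDerivAt
  have e1 := congrArg (fun T : E →L[ℝ] ℝ => T e) (hd2.fun_mul hA).fderiv
  have e2 := congrArg (fun T : E →L[ℝ] ℝ => T x) (hd2.fun_mul hB).fderiv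
  simp only [add_apply, smul_apply, smul_eq_mul,
    fderiv_axisCoeff_axis he hx, fderiv_radialCoeff_self hx] at e1 e2
  rw [e1, e2, norm_add_sq_real, norm_smul, mul_pow, inner_smul_right]
  have hF : ‖hardyField e a ε x‖ ^ 2 = axisCoeff e a ε x ^ 2
      + 2 * axisCoeff e a ε x * radialCoeff e a ε x * inner ℝ e x
      + radialCoeff e a ε x ^ 2 * ‖x‖ ^ 2 := by
    rw [hardyField, norm_add_sq_real, norm_smul, norm_smul, inner_smul_left, inner_smul_right,
      mul_pow, mul_pow, he]
    simp
    ring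
  have hG : inner ℝ (∇ φ x) (hardyField e a ε x) =
      axisCoeff e a ε x * fderiv ℝ φ x e + radialCoeff e a ε x * fderiv ℝ φ x x := by
    rw [hardyField, inner_add_right, inner_smul_right, inner_smul_right, inner_gradient_left,
      inner_gradient_left]
  rw [hF, hG, Real.norm_eq_abs, sq_abs]
  simp only [axisCoeff, radialCoeff, hardyPotential]
  generalize fderiv ℝ φ x e = p
  generalize fderiv ℝ φ x x = q
  generalize φ x = s
  generalize ‖x‖ = r at *
  generalize inner ℝ e x = y at *
  -- Taking the denominator `D` as a variable in place of `y` leaves a rational identity with only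
  -- `D` and `r` to clear.
  obtain ⟨D, hD⟩ : ∃ D, D = y + ε * r := ⟨_, rfl⟩
  obtain rfl : y = D - ε * r := by rw [hD]; ring
  rw [sub_add_cancel] at hx'
  simp only [sub_add_cancel]
  field_simp
  ring

theorem continuous_gradient {φ : E → ℝ} (hφ : ContDiff ℝ 1 φ) : Continuous (∇ φ) :=
  (InnerProductSpace.toDual ℝ E).symm.continuous.comp (hφ.continuous_fderiv one_ne_zero)

theorem support_gradient_subset (φ : E → ℝ) : Function.support (∇ φ) ⊆ tsupport φ := by
  intro x hx
  by_contra h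
  apply hx
  have : fderiv ℝ φ x = 0 := by
    by_contra h2
    exact h (support_fderiv_subset ℝ h2)
  simp [gradient, this]

/-- Integrated Picone identity for the field `-∇ log w`. -/
theorem integral_norm_gradient_sq (he : ‖e‖ = 1) {φ : E → ℝ} (hφ : ContDiff ℝ 1 φ)
    (hc : HasCompactSupport φ) (hs : tsupport φ ⊆ openCone e ε) :
    Integrable (fun x => ‖∇ φ x‖ ^ 2) ∧
    Integrable (fun x => hardyPotential e a ε x * φ x ^ 2) ∧
    Integrable (fun x => ‖∇ φ x + φ x • hardyField e a ε x‖ ^ 2) ∧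
    ∫ x, ‖∇ φ x‖ ^ 2 = (∫ x, hardyPotential e a ε x * φ x ^ 2)
      + ∫ x, ‖∇ φ x + φ x • hardyField e a ε x‖ ^ 2 := by
  have hU := isOpen_openCone e ε
  have hz : ∀ {x}, x ∉ tsupport φ → φ x = 0 := fun h => image_eq_zero_of_notMem_tsupport h
  have hgz : ∀ {x}, x ∉ tsupport φ → ∇ φ x = 0 := fun {x} h => by
    by_contra h2
    exact h (support_gradient_subset φ h2)
  have hcs : ∀ {F : Type} [NormedAddCommGroup F] {f : E → F}, Continuous f →
      (∀ x, x ∉ tsupport φ → f x = 0) → Integrable f := fun hf h0 =>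
    hf.integrable_of_hasCompactSupport (HasCompactSupport.intro hc fun x hx => h0 x hx)
  have hs2 : tsupport (fun x => φ x ^ 2) ⊆ openCone e ε :=
    (closure_mono fun x hx => by
      contrapose! hx
      simp only [Function.mem_support, not_not] at hx
      simp [hx]).trans hs
  have hc2 : HasCompactSupport (fun x => φ x ^ 2) := HasCompactSupport.intro hc fun x hx => by
    simp [hz hx]
  have hφ2 : ContDiff ℝ 1 (fun x => φ x ^ 2) := hφ.pow 2
  have hA := contDiff_mul_of_tsupport_subset hφ2 hU hs2 (contDiffOn_axisCoeff e a ε)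
  have hB := contDiff_mul_of_tsupport_subset hφ2 hU hs2 (contDiffOn_radialCoeff e a ε)
  have cA : HasCompactSupport (fun x => φ x ^ 2 * axisCoeff e a ε x) := hc2.mul_right
  have cB : HasCompactSupport (fun x => φ x ^ 2 * radialCoeff e a ε x) := hc2.mul_right
  have iG : Integrable (fun x => ‖∇ φ x‖ ^ 2) :=
    hcs ((continuous_gradient hφ).norm.pow 2) fun x hx => by simp [hgz hx]
  have iV : Integrable (fun x => hardyPotential e a ε x * φ x ^ 2) := by
    refine hcs ?_ fun x hx => by simp [hz hx]
    simpa only [mul_comm] using continuous_mul_of_tsupport_subset hφ2.continuous hU hs2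
      (continuousOn_hardyPotential e a ε)
  have iS : Integrable (fun x => ‖∇ φ x + φ x • hardyField e a ε x‖ ^ 2) := by
    refine hcs (Continuous.pow (Continuous.norm ?_) 2) fun x hx => by simp [hz hx, hgz hx]
    have h1 := continuous_mul_of_tsupport_subset hφ.continuous hU hs
      (contDiffOn_axisCoeff e a ε).continuousOn
    have h2 := continuous_mul_of_tsupport_subset hφ.continuous hU hs
      (contDiffOn_radialCoeff e a ε).continuousOn
    simp only [hardyField, smul_add, smul_smul]
    exact (continuous_gradient hφ).add ((h1.smul continuous_const).add (h2.smul continuous_id))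
  refine ⟨iG, iV, iS, ?_⟩
  have i1 := integral_fderiv_apply_eq_zero volume hA cA e
  have i2 := integral_fderiv_apply_self hB cB
  have hsum : ∫ x, (fderiv ℝ (fun x => φ x ^ 2 * axisCoeff e a ε x) x e +
      ((N : ℝ) * (φ x ^ 2 * radialCoeff e a ε x) +
        fderiv ℝ (fun x => φ x ^ 2 * radialCoeff e a ε x) x x)) = 0 := by
    refine (integral_add (integrable_fderiv_apply volume hA cA continuous_const)
      (((hB.continuous.integrable_of_hasCompactSupport cB).const_mul _).add
        (integrable_fderiv_apply volume hB cB continuous_id))).trans ?_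
    exact (congrArg₂ (· + ·) i1 i2).trans (add_zero 0)
  have hpt : ∀ x, fderiv ℝ (fun x => φ x ^ 2 * axisCoeff e a ε x) x e +
      ((N : ℝ) * (φ x ^ 2 * radialCoeff e a ε x) +
        fderiv ℝ (fun x => φ x ^ 2 * radialCoeff e a ε x) x x) =
      hardyPotential e a ε x * φ x ^ 2 + ‖∇ φ x + φ x • hardyField e a ε x‖ ^ 2
        - ‖∇ φ x‖ ^ 2 := by
    intro x
    by_cases hx : x ∈ tsupport φ
    · exact divergence_identity he hφ (hs hx)
    · have hev := notMem_tsupport_iff_eventuallyEq.1 hx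
      have hz0 : ∀ g : E → ℝ, fderiv ℝ (fun x => φ x ^ 2 * g x) x = 0 := fun g => by
        have : (fun x => φ x ^ 2 * g x) =ᶠ[𝓝 x] fun _ => (0 : ℝ) := by
          filter_upwards [hev] with y hy
          simp [hy]
        rw [this.fderiv_eq]
        simp
      simp [hz0, hz hx, hgz hx]
  simp only [hpt] at hsum
  have iVS : Integrable (fun x => hardyPotential e a ε x * φ x ^ 2
      + ‖∇ φ x + φ x • hardyField e a ε x‖ ^ 2) := iV.add iS
  rw [integral_sub iVS iG, integral_add iV iS] at hsum
  linarith

end HardyField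

/-! ### Hardy's inequality slightly beyond the half-space, and passage to the closure -/

section LowerBound

variable {N : ℕ}

local notation "E" => EuclideanSpace ℝ (Fin N)

/-- With `t = y / r` and `u = 1 / (t + ε)`, the right side is `n² / 4 - ε (n - 1) + ε (1 - ε) ((1 -
t²) u² - (n - 1) u)`. The exponent `1 - ε < 1` supplies the positive `u²` term, which absorbs `-(n -
1) u` as `u → ∞` at the edge of the region. The constant `3 n²` is not sharp. -/
theorem hardy_numerator_bound {n ε r y : ℝ} (hn : 1 ≤ n) (hε : 0 ≤ ε) (hε1 : ε ≤ 1 / 2) (hr : 0 < r)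
    (hy : |y| ≤ r) (hD : 0 < y + ε * r) :
    n ^ 2 / 4 - 3 * n ^ 2 * ε ≤ (n - 2) ^ 2 / 4
      + (1 - ε) * (1 - (1 - ε)) * (r ^ 2 - y ^ 2) * ((y + ε * r) ^ 2)⁻¹
      + (n - 1) * (1 - ε) * y * (y + ε * r)⁻¹ := by
  obtain ⟨t, rfl⟩ : ∃ t, y = t * r := ⟨y / r, by field_simp⟩
  have ht : |t| ≤ 1 := by
    rw [abs_mul, abs_of_pos hr] at hy
    nlinarith
  have hs : 0 < t + ε := by
    by_contra h
    nlinarith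
  obtain ⟨u, hu⟩ : ∃ u, u = (t + ε)⁻¹ := ⟨_, rfl⟩
  have hu0 : 0 < u := by rw [hu]; positivity
  have hsu : (t + ε) * u = 1 := by rw [hu]; field_simp
  have e1 : (r ^ 2 - (t * r) ^ 2) * ((t * r + ε * r) ^ 2)⁻¹ = (1 - t ^ 2) * u ^ 2 := by
    rw [hu, ← add_mul]
    field_simp
  have e2 : t * r * (t * r + ε * r)⁻¹ = 1 - ε * u := by
    rw [hu, ← add_mul]
    field_simp
    ring
  have key : -((n - 1) ^ 2 + 2 * (n - 1)) ≤ (1 - t ^ 2) * u ^ 2 - (n - 1) * u := by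
    have ht2 := abs_le.1 ht
    -- For `t ≤ 1 / 2`, also `t > -1 / 2`, so `1 - t² ≥ 3 / 4` and the quadratic in `u` is bounded
    -- below. For `t > 1 / 2`, `u` is at most `2`.
    rcases le_or_gt t (1 / 2) with h | h
    · have h3 : t ^ 2 ≤ 1 / 4 := by nlinarith
      nlinarith [sq_nonneg (u - 2 / 3 * (n - 1)),
        mul_nonneg (sub_nonneg.2 h3) (sq_nonneg u)]
    · have hu2 : u ≤ 2 := by nlinarith
      have : 0 ≤ (1 - t ^ 2) * u ^ 2 := mul_nonneg (by nlinarith) (by positivity)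
      nlinarith
  have e3 : (1 - ε) * (1 - (1 - ε)) * (r ^ 2 - (t * r) ^ 2) * ((t * r + ε * r) ^ 2)⁻¹ =
      (1 - ε) * ε * ((1 - t ^ 2) * u ^ 2) := by rw [← e1]; ring
  have e4 : (n - 1) * (1 - ε) * (t * r) * (t * r + ε * r)⁻¹ = (n - 1) * (1 - ε) * (1 - ε * u) := by
    rw [← e2]; ring
  rw [e3, e4]
  have h1 := mul_le_mul_of_nonneg_left key (mul_nonneg (by linarith : 0 ≤ 1 - ε) hε)
  have h2 : 0 ≤ ε * (n - 1) := mul_nonneg hε (by linarith)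
  have h3 : 0 ≤ ε * ε * (n - 1) := mul_nonneg (mul_nonneg hε hε) (by linarith)
  nlinarith [mul_nonneg hε (sq_nonneg (n - 1)), mul_nonneg h3 (by linarith : (0 : ℝ) ≤ n)]

theorem integrable_sq_div_norm_sq {φ : E → ℝ} (hφ : Continuous φ)
    (hc : HasCompactSupport φ) (h0 : (0 : E) ∉ tsupport φ) :
    Integrable (fun x => φ x ^ 2 / ‖x‖ ^ 2) := by
  have h1 := continuous_mul_of_tsupport_subset (g := fun x : E => (‖x‖ ^ 2)⁻¹) (U := {0}ᶜ) hφ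
    isOpen_compl_singleton (fun x hx => by rintro rfl; exact h0 hx)
    (ContinuousOn.inv₀ (by fun_prop) fun x hx => by
      have : x ≠ 0 := hx
      positivity)
  have h2 : Continuous (fun x => φ x ^ 2 / ‖x‖ ^ 2) := by
    refine (hφ.mul h1).congr fun x => ?_
    simp only [Pi.mul_apply]
    ring
  exact h2.integrable_of_hasCompactSupport (HasCompactSupport.intro hc fun x hx => by
    simp [image_eq_zero_of_notMem_tsupport hx])

/-- The Hardy inequality for smooth functions supported in a cone slightly larger than the
half-space. -/
theorem hardy_inequality_openCone (hN : 1 ≤ N) {e : EuclideanSpace ℝ (Fin N)} (he : ‖e‖ = 1)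
    {ε : ℝ} (hε : 0 ≤ ε) (hε1 : ε ≤ 1 / 2) {φ : E → ℝ} (hφ : ContDiff ℝ 1 φ)
    (hc : HasCompactSupport φ) (hs : tsupport φ ⊆ openCone e ε) :
    ((N : ℝ) ^ 2 / 4 - 3 * (N : ℝ) ^ 2 * ε) * ∫ x, φ x ^ 2 / ‖x‖ ^ 2 ≤ ∫ x, ‖∇ φ x‖ ^ 2 := by
  obtain ⟨-, hV, -, h⟩ := integral_norm_gradient_sq (a := 1 - ε) he hφ hc hs
  have hi := integrable_sq_div_norm_sq hφ.continuous hc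
    (fun h => ne_zero_of_mem_openCone (hs h) rfl)
  rw [h, ← integral_const_mul]
  refine le_add_of_le_of_nonneg (integral_mono (hi.const_mul _) hV fun x => ?_)
    (integral_nonneg fun x => by positivity)
  by_cases hx : x ∈ tsupport φ
  · have hx0 := ne_zero_of_mem_openCone (hs hx)
    have hr : 0 < ‖x‖ := norm_pos_iff.2 hx0
    have hy : |(inner ℝ e x : ℝ)| ≤ ‖x‖ := by simpa [he] using abs_real_inner_le_norm e x
    have := hardy_numerator_bound (n := N) (by exact_mod_cast hN) hε hε1 hr hy (hs hx)
    have h2 := mul_le_mul_of_nonneg_right this (by positivity : 0 ≤ φ x ^ 2 / ‖x‖ ^ 2)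
    refine h2.trans (le_of_eq ?_)
    simp only [hardyPotential]
    ring
  · simp [image_eq_zero_of_notMem_tsupport hx]

theorem norm_lastAxis (hN : 1 ≤ N) : ‖lastAxis N‖ = 1 := by
  obtain ⟨m, rfl⟩ : ∃ m, N = m + 1 := ⟨N - 1, by omega⟩
  have : lastAxis (m + 1) = EuclideanSpace.single (Fin.last m) (1 : ℝ) := by
    ext i
    simp [lastAxis, Fin.ext_iff]
  rw [this]
  simp

theorem inner_lastAxis (hN : 1 ≤ N) (x : E) :
    inner ℝ (lastAxis N) x = ‖x‖ * Real.cos (InnerProductGeometry.angle x (lastAxis N)) := by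
  have := InnerProductGeometry.cos_angle_mul_norm_mul_norm x (lastAxis N)
  rw [norm_lastAxis hN, mul_one] at this
  rw [real_inner_comm, ← this, mul_comm]

theorem cone_subset_openCone (hN : 1 ≤ N) {γ ε : ℝ} (hγ : γ ≤ Real.pi)
    (hε : -ε ≤ Real.cos γ) : (cone N γ : Set E) ⊆ openCone (lastAxis N) ε := by
  rintro x ⟨hx0, hx⟩
  have hr : 0 < ‖x‖ := norm_pos_iff.2 hx0
  have := Real.cos_lt_cos_of_nonneg_of_le_pi (InnerProductGeometry.angle_nonneg _ _) hγ hx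
  simp only [openCone, Set.mem_ofPred_eq]
  rw [inner_lastAxis hN]
  nlinarith

theorem mem_cone_half_pi (hN : 1 ≤ N) {x : E} :
    x ∈ cone N (Real.pi / 2) ↔ 0 < inner ℝ (lastAxis N) x := by
  constructor
  · intro h
    have := cone_subset_openCone hN (ε := 0) (by linarith [Real.pi_pos]) (by simp) h
    simpa [openCone] using this
  · intro h
    have hx0 : x ≠ 0 := by
      rintro rfl
      simp at h
    refine ⟨hx0, ?_⟩
    by_contra hx
    have h2 := Real.cos_nonpos_of_pi_div_two_le_of_le (not_lt.1 hx)
      (by linarith [InnerProductGeometry.angle_le_pi x (lastAxis N), Real.pi_pos])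
    rw [inner_lastAxis hN] at h
    nlinarith [norm_nonneg x]

theorem enorm_sq_div_enorm_sq {x : E} (hx : x ≠ 0) (s : ℝ) :
    ‖s‖ₑ ^ 2 / ‖x‖ₑ ^ 2 = ENNReal.ofReal (s ^ 2 / ‖x‖ ^ 2) := by
  rw [ENNReal.ofReal_div_of_pos (by positivity), ENNReal.ofReal_pow (norm_nonneg _), ofReal_norm,
    ← sq_abs, ENNReal.ofReal_pow (abs_nonneg _), ← Real.norm_eq_abs, ofReal_norm]

theorem setLIntegral_testFunction_sq_div {Ω : Opens E} (h0 : (0 : E) ∉ Ω) (φ : 𝓓(Ω, ℝ)) :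
    ∫⁻ x in Ω, ‖φ x‖ₑ ^ 2 / ‖x‖ₑ ^ 2 = ENNReal.ofReal (∫ x, φ x ^ 2 / ‖x‖ ^ 2) := by
  have h0' : (0 : E) ∉ tsupport φ := fun h => h0 (φ.tsupport_subset h)
  rw [ofReal_integral_eq_lintegral_ofReal
    (integrable_sq_div_norm_sq φ.continuous φ.hasCompactSupport h0')
    (ae_of_all _ fun x => by positivity), ← lintegral_indicator Ω.isOpen.measurableSet]
  refine lintegral_congr fun x => ?_
  by_cases hx : x ∈ (Ω : Set E)
  · rw [Set.indicator_of_mem hx]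
    exact enorm_sq_div_enorm_sq (fun h => h0 (h ▸ hx)) _
  · rw [Set.indicator_of_notMem hx,
      image_eq_zero_of_notMem_tsupport fun h => hx (φ.tsupport_subset h)]
    simp

theorem integrable_norm_gradient_sq {φ : E → ℝ} (hφ : ContDiff ℝ 1 φ)
    (hc : HasCompactSupport φ) : Integrable (fun x => ‖∇ φ x‖ ^ 2) :=
  ((continuous_gradient hφ).norm.pow 2).integrable_of_hasCompactSupport
    (HasCompactSupport.intro hc fun x hx => by
      by_contra h
      exact hx (support_gradient_subset φ fun h2 => h (by simp [h2])))

theorem TestFunction.contDiff_one {Ω : Opens E} (φ : 𝓓(Ω, ℝ)) : ContDiff ℝ 1 φ :=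
  φ.contDiff.of_le (by exact_mod_cast le_top)

theorem setLIntegral_testFunction_gradient_sq {Ω : Opens E} (φ : 𝓓(Ω, ℝ)) :
    ∫⁻ x in Ω, ‖∇ φ x‖ₑ ^ 2 = ENNReal.ofReal (∫ x, ‖∇ φ x‖ ^ 2) := by
  rw [ofReal_integral_eq_lintegral_ofReal
    (integrable_norm_gradient_sq φ.contDiff_one φ.hasCompactSupport)
    (ae_of_all _ fun x => by positivity), ← lintegral_indicator Ω.isOpen.measurableSet]
  refine lintegral_congr fun x => ?_
  by_cases hx : x ∈ (Ω : Set E)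
  · rw [Set.indicator_of_mem hx, ENNReal.ofReal_pow (norm_nonneg _), ofReal_norm]
  · have : ∇ φ x = 0 := by
      by_contra h
      exact hx (φ.tsupport_subset (support_gradient_subset φ h))
    rw [Set.indicator_of_notMem hx, this]
    simp

/-- A Hardy inequality on test functions bounds the Hardy constant from below. -/
theorem le_hardyConstant {Ω : Opens E} {c : ℝ≥0∞} (hc0 : c ≠ 0) (hct : c ≠ ∞)
    (h0 : (0 : E) ∉ Ω)
    (h : ∀ φ : 𝓓(Ω, ℝ), c * ∫⁻ x in Ω, ‖φ x‖ₑ ^ 2 / ‖x‖ₑ ^ 2 ≤ ∫⁻ x in Ω, ‖∇ φ x‖ₑ ^ 2) :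
    c ≤ hardyConstant Ω := by
  refine le_sInf ?_
  rintro q ⟨u, g, ⟨⟨hu, hg, -⟩, φ, hφu, hφg⟩, hne, rfl⟩
  have sq_eLpNorm : ∀ {F : Type} [NormedAddCommGroup F] (f : E → F),
      eLpNorm f 2 (volume.restrict Ω) ^ 2 = ∫⁻ x in Ω, ‖f x‖ₑ ^ 2 := by
    intro F _ f
    have := eLpNorm_nnreal_pow_eq_lintegral (μ := volume.restrict (Ω : Set E)) (f := f)
      (p := 2) (by norm_num)
    simpa using this
  have hgfin : ∫⁻ x in Ω, ‖g x‖ₑ ^ 2 ≠ ∞ := by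
    rw [← sq_eLpNorm]
    exact ENNReal.pow_ne_top hg.2.ne
  -- Convergence of the norms, by the triangle inequality in both directions.
  have hgrad : Tendsto (fun n => ∫⁻ x in Ω, ‖∇ (φ n) x‖ₑ ^ 2) atTop
      (𝓝 (∫⁻ x in Ω, ‖g x‖ₑ ^ 2)) := by
    simp only [← sq_eLpNorm]
    refine ENNReal.Tendsto.pow ?_
    have hm : ∀ n, AEStronglyMeasurable (∇ (φ n)) (volume.restrict (Ω : Set E)) := fun n =>
      (continuous_gradient (φ n).contDiff_one).aestronglyMeasurable
    have up : ∀ n, eLpNorm (∇ (φ n)) 2 (volume.restrict Ω) ≤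
        eLpNorm g 2 (volume.restrict Ω)
          + eLpNorm (fun x => ∇ (φ n) x - g x) 2 (volume.restrict Ω) := fun n => by
      have := eLpNorm_add_le hg.1 ((hm n).sub hg.1) (p := 2) (by norm_num)
      change _ ≤ _ + eLpNorm (∇ (φ n) - g) 2 _
      simpa using this
    have lo : ∀ n, eLpNorm g 2 (volume.restrict Ω)
        - eLpNorm (fun x => ∇ (φ n) x - g x) 2 (volume.restrict Ω) ≤
        eLpNorm (∇ (φ n)) 2 (volume.restrict Ω) := fun n => by
      have := eLpNorm_sub_le (hm n) ((hm n).sub hg.1) (p := 2) (by norm_num)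
      rw [tsub_le_iff_right]
      change _ ≤ _ + eLpNorm (∇ (φ n) - g) 2 _
      simpa using this
    refine tendsto_of_tendsto_of_tendsto_of_le_of_le ?_ ?_ lo up
    · simpa using ENNReal.Tendsto.sub tendsto_const_nhds hφg (Or.inl hg.2.ne)
    · simpa using tendsto_const_nhds.add hφg
  -- The weight is singular, so `L²` convergence does not control the weighted integral directly; an
  -- a.e. convergent subsequence and Fatou give the inequality needed.
  obtain ⟨ns, hns, hae⟩ := (tendstoInMeasure_of_tendsto_eLpNorm (p := 2) (by norm_num)
    (fun n => (φ n).continuous.aestronglyMeasurable) hu.1 hφu).exists_seq_tendsto_ae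
  have hden : c * ∫⁻ x in Ω, ‖u x‖ₑ ^ 2 / ‖x‖ₑ ^ 2 ≤ ∫⁻ x in Ω, ‖g x‖ₑ ^ 2 := by
    have hF : ∫⁻ x in Ω, ‖u x‖ₑ ^ 2 / ‖x‖ₑ ^ 2 ≤
        liminf (fun n => ∫⁻ x in Ω, ‖φ (ns n) x‖ₑ ^ 2 / ‖x‖ₑ ^ 2) atTop := by
      refine le_trans (lintegral_mono_ae ?_) (lintegral_liminf_le' fun n => ?_)
      · filter_upwards [hae, ae_restrict_mem Ω.isOpen.measurableSet] with x hx hxΩ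
        have hx0 : x ≠ 0 := fun h => h0 (h ▸ hxΩ)
        refine le_of_eq (Tendsto.liminf_eq ?_).symm
        exact ENNReal.Tendsto.div_const (ENNReal.Tendsto.pow hx.enorm)
          (Or.inr (by simp [hx0]))
      · exact ((φ (ns n)).continuous.measurable.enorm.pow_const 2).div
          (measurable_id.enorm.pow_const 2) |>.aemeasurable
    rw [mul_comm, ← ENNReal.le_div_iff_mul_le (Or.inl hc0) (Or.inl hct)]
    refine hF.trans ?_
    have hle : ∀ n, ∫⁻ x in Ω, ‖φ (ns n) x‖ₑ ^ 2 / ‖x‖ₑ ^ 2 ≤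
        (∫⁻ x in Ω, ‖∇ (φ (ns n)) x‖ₑ ^ 2) / c := fun n => by
      rw [ENNReal.le_div_iff_mul_le (Or.inl hc0) (Or.inl hct), mul_comm]
      exact h _
    refine (liminf_le_liminf (Eventually.of_forall hle)).trans (le_of_eq (Tendsto.liminf_eq ?_))
    exact ENNReal.Tendsto.div_const (hgrad.comp hns.tendsto_atTop) (Or.inr hc0)
  rw [ENNReal.le_div_iff_mul_le]
  · exact hden
  -- A vanishing weighted integral would force `u = 0` a.e.
  · left
    intro hz
    apply hne
    have hm : AEMeasurable (fun x => ‖u x‖ₑ ^ 2 / ‖x‖ₑ ^ 2) (volume.restrict (Ω : Set E)) :=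
      (hu.1.enorm.pow_const 2).div (measurable_id.enorm.pow_const 2).aemeasurable
    filter_upwards [(lintegral_eq_zero_iff' hm).1 hz] with x hx
    simpa [ENNReal.div_eq_zero_iff] using hx
  · right
    exact hgfin

end LowerBound

/-! ### Test functions as competitors -/

section UpperBound

variable {N : ℕ}

local notation "E" => EuclideanSpace ℝ (Fin N)

theorem hasCompactSupport_gradient {φ : E → ℝ} (hc : HasCompactSupport φ) :
    HasCompactSupport (∇ φ) :=
  hc.mono' (support_gradient_subset φ)

theorem memH10_testFunction {Ω : Opens E} (φ : 𝓓(Ω, ℝ)) : MemH10 Ω φ (∇ φ) := by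
  have hg := continuous_gradient φ.contDiff_one
  have hgc := hasCompactSupport_gradient φ.hasCompactSupport
  refine ⟨⟨(φ.continuous.memLp_of_hasCompactSupport φ.hasCompactSupport).restrict _,
    (hg.memLp_of_hasCompactSupport hgc).restrict _,
    φ.continuous.locallyIntegrable.locallyIntegrableOn _,
    hg.locallyIntegrable.locallyIntegrableOn _, fun ψ v => ?_⟩, fun _ => φ, by simp, by simp⟩
  have hz : ∀ x, x ∉ (Ω : Set E) → φ x = 0 := fun x hx =>
    image_eq_zero_of_notMem_tsupport fun h => hx (φ.tsupport_subset h)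
  have hz' : ∀ x, x ∉ (Ω : Set E) → ψ x = 0 := fun x hx =>
    image_eq_zero_of_notMem_tsupport fun h => hx (ψ.tsupport_subset h)
  rw [setIntegral_eq_integral_of_forall_compl_eq_zero fun x hx => by simp [hz x hx],
    setIntegral_eq_integral_of_forall_compl_eq_zero fun x hx => by simp [hz' x hx]]
  simp only [inner_gradient_left]
  have hφ' : Continuous fun x => fderiv ℝ φ x v :=
    (φ.contDiff_one.continuous_fderiv one_ne_zero).clm_apply continuous_const
  have hψ' : Continuous fun x => fderiv ℝ ψ x v :=
    (ψ.contDiff_one.continuous_fderiv one_ne_zero).clm_apply continuous_const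
  exact integral_mul_fderiv_eq_neg_fderiv_mul_of_integrable
    ((hφ'.mul ψ.continuous).integrable_of_hasCompactSupport ψ.hasCompactSupport.mul_left)
    ((φ.continuous.mul hψ').integrable_of_hasCompactSupport φ.hasCompactSupport.mul_right)
    ((φ.continuous.mul ψ.continuous).integrable_of_hasCompactSupport
      φ.hasCompactSupport.mul_right)
    (fun x _ => φ.contDiff_one.differentiable one_ne_zero x)
    (fun x _ => ψ.contDiff_one.differentiable one_ne_zero x)

theorem hardyConstant_le_of_testFunction {Ω : Opens E} (h0 : (0 : E) ∉ Ω) (φ : 𝓓(Ω, ℝ)) {c : ℝ}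
    (hpos : 0 < ∫ x, φ x ^ 2 / ‖x‖ ^ 2)
    (h : ∫ x, ‖∇ φ x‖ ^ 2 ≤ c * ∫ x, φ x ^ 2 / ‖x‖ ^ 2) :
    hardyConstant Ω ≤ ENNReal.ofReal c := by
  have hne : ¬ φ =ᵐ[volume.restrict Ω] 0 := by
    intro hz
    have : ∫⁻ x in Ω, ‖φ x‖ₑ ^ 2 / ‖x‖ₑ ^ 2 = 0 := by
      rw [lintegral_congr_ae (g := fun _ => 0), lintegral_zero]
      filter_upwards [hz] with x hx
      simp [hx]
    rw [setLIntegral_testFunction_sq_div h0, ENNReal.ofReal_eq_zero] at this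
    linarith
  unfold hardyConstant
  refine le_trans (sInf_le ⟨φ, ∇ φ, memH10_testFunction φ, hne, rfl⟩) ?_
  rw [setLIntegral_testFunction_sq_div h0, setLIntegral_testFunction_gradient_sq]
  refine ENNReal.div_le_of_le_mul ?_
  rw [← ENNReal.ofReal_mul' hpos.le]
  exact ENNReal.ofReal_le_ofReal h

end UpperBound

/-! ### Truncated trial functions in the half-space -/

section TestFamily

theorem Real.smoothTransition.deriv_eq_zero {z : ℝ} (hz : z ∉ Set.Icc (0 : ℝ) 1) :
    deriv Real.smoothTransition z = 0 := by
  rcases lt_or_ge z 0 with h | h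
  · have : Real.smoothTransition =ᶠ[𝓝 z] fun _ => (0 : ℝ) := by
      filter_upwards [Iio_mem_nhds h] with y hy
      exact Real.smoothTransition.zero_of_nonpos (le_of_lt hy)
    rw [this.deriv_eq, deriv_const]
  · have h1 : 1 < z := by
      by_contra h1
      exact hz ⟨h, not_lt.1 h1⟩
    have : Real.smoothTransition =ᶠ[𝓝 z] fun _ => (1 : ℝ) := by
      filter_upwards [Ioi_mem_nhds h1] with y hy
      exact Real.smoothTransition.one_of_one_le (le_of_lt hy)
    rw [this.deriv_eq, deriv_const]

theorem Real.smoothTransition.continuous_deriv : Continuous (deriv Real.smoothTransition) :=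
  (Real.smoothTransition.contDiff (n := 1)).continuous_deriv le_rfl

/-- At `z = j q - 1` the product is `j q τ'(j q - 1)`, so this bounds the cutoff term uniformly in
`j`. -/
theorem Real.smoothTransition.exists_deriv_bound :
    ∃ C : ℝ, 0 ≤ C ∧ ∀ z, |(z + 1) * deriv Real.smoothTransition z| ≤ C := by
  obtain ⟨C, hC⟩ := (isCompact_Icc (a := (0 : ℝ)) (b := 1)).exists_bound_of_continuousOn
    (f := fun z => (z + 1) * deriv Real.smoothTransition z)
    ((continuous_id.add continuous_const).mul
      Real.smoothTransition.continuous_deriv).continuousOn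
  have hC0 : 0 ≤ C := (norm_nonneg _).trans (hC 0 (by simp))
  refine ⟨C, hC0, fun z => ?_⟩
  by_cases hz : z ∈ Set.Icc (0 : ℝ) 1
  · exact hC z hz
  · simpa [Real.smoothTransition.deriv_eq_zero hz] using hC0

variable {N : ℕ}

local notation "E" => EuclideanSpace ℝ (Fin N)

/-- In polar coordinates the density is at most `r ^ (2k - 1)` near `0` and `r ^ (-1 - 2k)` at
infinity. This is why `q ^ k` is included: it repairs the logarithmic divergence at both ends. -/
theorem integrable_radial_weight (hN : 1 ≤ N) {k : ℝ} (hk : 0 < k) :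
    Integrable (fun x : E => ‖x‖ ^ (-(N : ℝ)) * (‖x‖ / (1 + ‖x‖ ^ 2)) ^ (2 * k)) := by
  have : Nonempty (Fin N) := ⟨⟨0, hN⟩⟩
  rw [integrable_fun_norm_addHaar volume
    (f := fun r : ℝ => r ^ (-(N : ℝ)) * (r / (1 + r ^ 2)) ^ (2 * k)), finrank_euclideanSpace,
    Fintype.card_fin]
  have hpt : ∀ r ∈ Set.Ioi (0 : ℝ), r ^ (N - 1) • (r ^ (-(N : ℝ)) * (r / (1 + r ^ 2)) ^ (2 * k))
      = r ^ (-1 : ℝ) * (r / (1 + r ^ 2)) ^ (2 * k) := by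
    intro r (hr : 0 < r)
    rw [smul_eq_mul, ← mul_assoc, ← Real.rpow_natCast, ← Real.rpow_add hr, Nat.cast_sub hN]
    congr 2
    push_cast
    ring
  rw [integrableOn_congr_fun hpt measurableSet_Ioi, ← Set.Ioc_union_Ioi_eq_Ioi zero_le_one]
  have hm : Measurable fun r : ℝ => r ^ (-1 : ℝ) * (r / (1 + r ^ 2)) ^ (2 * k) := by fun_prop
  refine IntegrableOn.union ?_ ?_
  · have h1 : IntegrableOn (fun r : ℝ => r ^ (2 * k - 1)) (Set.Ioc 0 1) := by
      rw [← intervalIntegrable_iff_integrableOn_Ioc_of_le zero_le_one]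
      exact intervalIntegral.intervalIntegrable_rpow' (by linarith)
    refine Integrable.mono' h1 hm.aestronglyMeasurable ?_
    filter_upwards [ae_restrict_mem measurableSet_Ioc] with r hr
    have hr0 : 0 < r := hr.1
    rw [Real.norm_of_nonneg (by positivity), sub_eq_neg_add, Real.rpow_add hr0]
    refine mul_le_mul_of_nonneg_left (Real.rpow_le_rpow (by positivity) ?_ (by positivity))
      (by positivity)
    exact div_le_self hr0.le (by nlinarith)
  · have h1 : IntegrableOn (fun r : ℝ => r ^ (-1 - 2 * k)) (Set.Ioi 1) :=
      integrableOn_Ioi_rpow_of_lt (by linarith) one_pos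
    refine Integrable.mono' h1 hm.aestronglyMeasurable ?_
    filter_upwards [ae_restrict_mem measurableSet_Ioi] with r hr
    have hr0 : 0 < r := one_pos.trans hr
    rw [Real.norm_of_nonneg (by positivity), sub_eq_add_neg, Real.rpow_add hr0,
      Real.rpow_neg hr0.le (2 * k), ← Real.inv_rpow hr0.le]
    refine mul_le_mul_of_nonneg_left (Real.rpow_le_rpow (by positivity) ?_ (by positivity))
      (by positivity)
    rw [div_le_iff₀ (by positivity)]
    field_simp
    nlinarith

/-- A smooth function, positive on the half-space `⟪e, x⟫ > 0`, whose superlevel sets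
`{c ≤ halfSpaceDefining e}`, `c > 0`, are compact. -/
noncomputable def halfSpaceDefining (e x : E) : ℝ := inner ℝ e x / (1 + ‖x‖ ^ 2)

/-- The factor `⟪e, x⟫ ^ k ‖x‖ ^ (-N / 2 - k) q ^ k` with `q = halfSpaceDefining e`. -/
noncomputable def profile (e : E) (k : ℝ) (x : E) : ℝ :=
  (inner ℝ e x : ℝ) ^ k * ‖x‖ ^ (-((N : ℝ) / 2 + k)) * halfSpaceDefining e x ^ k

/-- Truncations of the near-optimal function `⟪e, x⟫ profile e k x`. -/
noncomputable def truncation (e : E) (k j : ℝ) (x : E) : ℝ :=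
  Real.smoothTransition (j * halfSpaceDefining e x - 1) * (inner ℝ e x * profile e k x)

theorem contDiff_halfSpaceDefining {n : WithTop ℕ∞} (e : E) :
    ContDiff ℝ n (halfSpaceDefining e) :=
  (contDiff_const.inner ℝ contDiff_id).div (contDiff_const.add (contDiff_id.norm_sq ℝ))
    fun x => by positivity

variable {e : EuclideanSpace ℝ (Fin N)} {k j : ℝ}

theorem mem_openCone_zero {x : E} : x ∈ openCone e 0 ↔ 0 < inner ℝ e x := by
  simp [openCone]

theorem halfSpaceDefining_pos {x : E} (hx : x ∈ openCone e 0) : 0 < halfSpaceDefining e x :=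
  div_pos (mem_openCone_zero.1 hx) (by positivity)

theorem contDiffOn_profile {n : ℕ∞} (e : E) (k : ℝ) :
    ContDiffOn ℝ n (profile e k) (openCone e 0) := by
  intro x hx
  have hy : (inner ℝ e x : ℝ) ≠ 0 := (mem_openCone_zero.1 hx).ne'
  have hx0 := ne_zero_of_mem_openCone hx
  refine ContDiffAt.contDiffWithinAt ?_
  unfold profile
  have hi : ContDiffAt ℝ n (fun x : E => (inner ℝ e x : ℝ)) x :=
    contDiffAt_const.inner ℝ contDiffAt_id
  exact ((hi.rpow_const_of_ne hy).mul ((contDiffAt_norm ℝ hx0).rpow_const_of_ne (by simpa))).mul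
    ((contDiff_halfSpaceDefining e).contDiffAt.rpow_const_of_ne (halfSpaceDefining_pos hx).ne')

theorem tsupport_cutoff_subset (e : E) (j : ℝ) :
    tsupport (fun x => Real.smoothTransition (j * halfSpaceDefining e x - 1)) ⊆
      {x | 1 ≤ j * halfSpaceDefining e x} := by
  refine closure_minimal (fun x hx => ?_) (isClosed_le continuous_const
    (continuous_const.mul (contDiff_halfSpaceDefining (n := 0) e).continuous))
  by_contra h
  exact hx (Real.smoothTransition.zero_of_nonpos (by
    simp only [Set.mem_ofPred_eq] at h
    linarith))

theorem superlevel_subset_openCone (hj : 0 < j) :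
    {x | 1 ≤ j * halfSpaceDefining e x} ⊆ openCone e 0 := by
  intro x hx
  rw [mem_openCone_zero]
  have h1 : 0 < halfSpaceDefining e x := by
    by_contra h
    simp only [Set.mem_ofPred_eq] at hx
    nlinarith
  have h2 := mul_pos h1 (by positivity : 0 < 1 + ‖x‖ ^ 2)
  rwa [halfSpaceDefining, div_mul_cancel₀ _ (by positivity)] at h2

/-- On this set `1 + r² ≤ j y ≤ j r`. -/
theorem superlevel_subset_closedBall (he : ‖e‖ = 1) (hj : 0 < j) :
    {x | 1 ≤ j * halfSpaceDefining e x} ⊆ Metric.closedBall 0 j := by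
  intro x hx
  simp only [Set.mem_ofPred_eq, halfSpaceDefining, mul_div_assoc'] at hx
  rw [le_div_iff₀ (by positivity)] at hx
  have hy : (inner ℝ e x : ℝ) ≤ ‖x‖ := by simpa [he] using real_inner_le_norm e x
  rw [mem_closedBall_zero_iff]
  nlinarith [norm_nonneg x]

theorem hasCompactSupport_cutoff (he : ‖e‖ = 1) (hj : 0 < j) :
    HasCompactSupport (fun x => Real.smoothTransition (j * halfSpaceDefining e x - 1)) :=
  (isCompact_closedBall (0 : E) j).of_isClosed_subset (isClosed_tsupport _)
    ((tsupport_cutoff_subset e j).trans (superlevel_subset_closedBall he hj))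

theorem contDiff_truncation {n : ℕ∞} (hj : 0 < j) : ContDiff ℝ n (truncation e k j) := by
  refine contDiff_mul_of_tsupport_subset (U := openCone e 0) ?_ (isOpen_openCone e 0)
    ((tsupport_cutoff_subset e j).trans (superlevel_subset_openCone hj))
    ((contDiff_const.inner ℝ contDiff_id).contDiffOn.mul (contDiffOn_profile e k))
  exact Real.smoothTransition.contDiff.comp
    ((contDiff_const.mul (contDiff_halfSpaceDefining e)).sub contDiff_const)

theorem hasCompactSupport_truncation (he : ‖e‖ = 1) (hj : 0 < j) :
    HasCompactSupport (truncation e k j) :=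
  (hasCompactSupport_cutoff he hj).mul_right

theorem tsupport_truncation_subset (hj : 0 < j) :
    tsupport (truncation e k j) ⊆ openCone e 0 :=
  tsupport_mul_subset_left.trans
    ((tsupport_cutoff_subset e j).trans (superlevel_subset_openCone hj))

end TestFamily

/-! ### The trial functions beat `N² / 4 + N k + k²` -/

section NearOptimal

variable {N : ℕ}

local notation "E" => EuclideanSpace ℝ (Fin N)

variable {e : EuclideanSpace ℝ (Fin N)} {k j : ℝ}

/-- The gradient of `halfSpaceDefining e` multiplied by `1 + ‖x‖ ^ 2`. -/
noncomputable def scaledGradient (e x : E) : E :=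
  e - (2 * inner ℝ e x / (1 + ‖x‖ ^ 2)) • x

/-- The squared norm is exactly `1 - 4 q²`. -/
theorem norm_scaledGradient_sq_le (he : ‖e‖ = 1) (x : E) : ‖scaledGradient e x‖ ^ 2 ≤ 1 := by
  rw [scaledGradient, norm_sub_sq_real, norm_smul, mul_pow, inner_smul_right, he,
    Real.norm_eq_abs, sq_abs]
  generalize inner ℝ e x = y
  have h : (0 : ℝ) < 1 + ‖x‖ ^ 2 := by positivity
  have : (1 : ℝ) ^ 2 - 2 * (2 * y / (1 + ‖x‖ ^ 2) * y) + (2 * y / (1 + ‖x‖ ^ 2)) ^ 2 * ‖x‖ ^ 2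
      = 1 - 4 * (y / (1 + ‖x‖ ^ 2)) ^ 2 := by
    field_simp
    ring
  rw [this]
  nlinarith [sq_nonneg (y / (1 + ‖x‖ ^ 2))]

theorem hasFDerivAt_halfSpaceDefining (x : E) :
    HasFDerivAt (halfSpaceDefining e) ((1 + ‖x‖ ^ 2)⁻¹ • innerSL ℝ (scaledGradient e x)) x := by
  have h : (1 : ℝ) + ‖x‖ ^ 2 ≠ 0 := by positivity
  have hI : HasFDerivAt (fun x : E => (inner ℝ e x : ℝ)) (innerSL ℝ e) x :=
    (innerSL ℝ e).hasFDerivAt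
  have h1 := hI.fun_mul ((hasDerivAt_inv h).comp_hasFDerivAt x
    ((hasStrictFDerivAt_norm_sq x).hasFDerivAt.const_add 1))
  refine HasFDerivAt.congr_fderiv (f := halfSpaceDefining e) h1 ?_
  ext v
  simp [scaledGradient]
  field_simp
  ring

/-- The logarithmic derivative (times `q`) of `τ (j q - 1) q ^ k`, with `τ` the smooth
transition function. -/
noncomputable def cutoffSlope (k j q : ℝ) : ℝ :=
  k * Real.smoothTransition (j * q - 1) + j * q * deriv Real.smoothTransition (j * q - 1)

/-- The truncation is `w q ^ k τ(j q - 1)`, so the left side is `w ∇(q ^ k τ(j q - 1))`; the profile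
is `w q ^ k / y`, and `q (1 + r²) = y`. -/
theorem gradient_truncation_add {x : E} (hx : x ∈ openCone e 0) :
    ∇ (truncation e k j) x + truncation e k j x • hardyField e (1 + k) 0 x =
      (profile e k x * cutoffSlope k j (halfSpaceDefining e x)) • scaledGradient e x := by
  have hy : (inner ℝ e x : ℝ) ≠ 0 := (mem_openCone_zero.1 hx).ne'
  have hx0 := ne_zero_of_mem_openCone hx
  have hr : ‖x‖ ≠ 0 := by positivity
  have hq := (halfSpaceDefining_pos hx).ne'
  have h1r : (1 : ℝ) + ‖x‖ ^ 2 ≠ 0 := by positivity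
  have hI : HasFDerivAt (fun x : E => (inner ℝ e x : ℝ)) (innerSL ℝ e) x :=
    (innerSL ℝ e).hasFDerivAt
  have hQ := hasFDerivAt_halfSpaceDefining (e := e) x
  have hτ := ((Real.smoothTransition.contDiff (n := 1)).differentiable one_ne_zero
    (j * halfSpaceDefining e x - 1)).hasDerivAt.comp_hasFDerivAt x ((hQ.const_mul j).sub_const 1)
  have hP := ((hI.rpow_const (p := k) (Or.inl hy)).fun_mul
    ((hasFDerivAt_norm_of_ne_zero hx0).rpow_const (p := -((N : ℝ) / 2 + k)) (Or.inl hr))).fun_mul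
    (hQ.rpow_const (p := k) (Or.inl hq))
  have hT := hτ.fun_mul (hI.fun_mul hP)
  have hG : HasGradientAt (truncation e k j)
      ((profile e k x * cutoffSlope k j (halfSpaceDefining e x)) • scaledGradient e x
        - truncation e k j x • hardyField e (1 + k) 0 x) x := by
    rw [hasGradientAt_iff_hasFDerivAt]
    refine HasFDerivAt.congr_fderiv (f := truncation e k j) hT ?_
    ext v
    simp only [hardyField, inner_sub_left, inner_add_left, inner_smul_left, add_apply, smul_apply,
      smul_eq_mul, innerSL_apply_apply, InnerProductSpace.toDual_apply_apply, Real.rpow_sub_one hy,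
      Real.rpow_sub_one hr, Real.rpow_sub_one hq, axisCoeff, radialCoeff, truncation, profile,
      cutoffSlope, Function.comp_apply, RCLike.conj_to_real, zero_mul, add_zero]
    have hye : (inner ℝ e x : ℝ) = halfSpaceDefining e x * (1 + ‖x‖ ^ 2) := by
      rw [halfSpaceDefining, div_mul_cancel₀ _ h1r]
    generalize (inner ℝ e x : ℝ) ^ k = Y
    generalize ‖x‖ ^ (-((N : ℝ) / 2 + k)) = R
    generalize halfSpaceDefining e x ^ k = Q
    generalize Real.smoothTransition (j * halfSpaceDefining e x - 1) = T
    generalize deriv Real.smoothTransition (j * halfSpaceDefining e x - 1) = T'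
    generalize inner ℝ (scaledGradient e x) v = g
    generalize inner ℝ e v = p
    generalize inner ℝ x v = z
    rw [hye] at hy ⊢
    generalize halfSpaceDefining e x = q at *
    field_simp
    ring
  rw [hG.gradient]
  abel

/-- For `a = 1 + k`, `ε = 0`, the potential is exactly `(N² / 4 + N k + k²) / r² - (k² + k) / y²`.
The `1 / y²` term becomes the negative part of the defect, as the truncation divided by `y` is the
profile times `τ`. -/
theorem truncation_inequality (he : ‖e‖ = 1) {x : E} (hx : x ∈ openCone e 0) :
    hardyPotential e (1 + k) 0 x * truncation e k j x ^ 2 +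
      ‖∇ (truncation e k j) x + truncation e k j x • hardyField e (1 + k) 0 x‖ ^ 2 ≤
    ((N : ℝ) ^ 2 / 4 + N * k + k ^ 2) * (truncation e k j x ^ 2 / ‖x‖ ^ 2) +
      profile e k x ^ 2 * (cutoffSlope k j (halfSpaceDefining e x) ^ 2 -
        (k ^ 2 + k) * Real.smoothTransition (j * halfSpaceDefining e x - 1) ^ 2) := by
  have hy : (inner ℝ e x : ℝ) ≠ 0 := (mem_openCone_zero.1 hx).ne'
  have hx0 := ne_zero_of_mem_openCone hx
  have hr : ‖x‖ ≠ 0 := by positivity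
  rw [gradient_truncation_add hx, norm_smul, mul_pow, Real.norm_eq_abs, sq_abs]
  have h1 := mul_le_mul_of_nonneg_left (norm_scaledGradient_sq_le he x)
    (sq_nonneg (profile e k x * cutoffSlope k j (halfSpaceDefining e x)))
  refine (add_le_add_right h1 _).trans (le_of_eq ?_)
  simp only [hardyPotential, truncation, zero_mul, add_zero]
  field_simp
  ring

theorem measurable_profile (e : E) (k : ℝ) : Measurable (profile e k) := by
  have := (contDiff_halfSpaceDefining (n := 0) e).continuous.measurable
  unfold profile
  fun_prop

theorem profile_pos {x : E} (hx : x ∈ openCone e 0) : 0 < profile e k x := by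
  have hx0 := ne_zero_of_mem_openCone hx
  exact mul_pos (mul_pos (Real.rpow_pos_of_pos (mem_openCone_zero.1 hx) _)
    (Real.rpow_pos_of_pos (norm_pos_iff.2 hx0) _))
    (Real.rpow_pos_of_pos (halfSpaceDefining_pos hx) _)

theorem profile_sq_le (he : ‖e‖ = 1) (hk : 0 < k) {x : E} (hx : x ∈ openCone e 0) :
    profile e k x ^ 2 ≤ ‖x‖ ^ (-(N : ℝ)) * (‖x‖ / (1 + ‖x‖ ^ 2)) ^ (2 * k) := by
  have hx0 := ne_zero_of_mem_openCone hx
  have hr : 0 < ‖x‖ := norm_pos_iff.2 hx0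
  have hy0 := mem_openCone_zero.1 hx
  have hy : (inner ℝ e x : ℝ) ≤ ‖x‖ := by simpa [he] using real_inner_le_norm e x
  have hq : halfSpaceDefining e x ≤ ‖x‖ / (1 + ‖x‖ ^ 2) := by
    unfold halfSpaceDefining
    gcongr
  have h1 : profile e k x ≤ ‖x‖ ^ k * ‖x‖ ^ (-((N : ℝ) / 2 + k)) * (‖x‖ / (1 + ‖x‖ ^ 2)) ^ k := by
    unfold profile
    have := (halfSpaceDefining_pos hx).le
    gcongr
  have h2 : (‖x‖ ^ k * ‖x‖ ^ (-((N : ℝ) / 2 + k)) * (‖x‖ / (1 + ‖x‖ ^ 2)) ^ k) ^ 2 =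
      ‖x‖ ^ (-(N : ℝ)) * (‖x‖ / (1 + ‖x‖ ^ 2)) ^ (2 * k) := by
    rw [← Real.rpow_add hr, mul_pow, ← Real.rpow_natCast, ← Real.rpow_natCast,
      ← Real.rpow_mul hr.le, ← Real.rpow_mul (by positivity)]
    congr 2
    · push_cast
      ring
    · push_cast
      ring
  rw [← h2]
  exact pow_le_pow_left₀ (profile_pos hx).le h1 2

theorem integrable_profile_sq (hN : 1 ≤ N) (he : ‖e‖ = 1) (hk : 0 < k) :
    Integrable ((openCone e 0).indicator fun x => profile e k x ^ 2) := by
  refine Integrable.mono' (integrable_radial_weight hN hk)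
    (((measurable_profile e k).pow_const 2).indicator
      (isOpen_openCone e 0).measurableSet).aestronglyMeasurable (ae_of_all _ fun x => ?_)
  by_cases hx : x ∈ openCone e 0
  · rw [Set.indicator_of_mem hx, Real.norm_of_nonneg (sq_nonneg _)]
    exact profile_sq_le he hk hx
  · rw [Set.indicator_of_notMem hx, norm_zero]
    positivity

theorem integral_profile_sq_pos (hN : 1 ≤ N) (he : ‖e‖ = 1) (hk : 0 < k) :
    0 < ∫ x, (openCone e 0).indicator (fun x => profile e k x ^ 2) x := by
  rw [integral_pos_iff_support_of_nonneg
    (fun x => Set.indicator_nonneg (fun x _ => sq_nonneg _) x) (integrable_profile_sq hN he hk)]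
  have hsub : openCone e 0 ⊆
      Function.support ((openCone e 0).indicator fun x => profile e k x ^ 2) := fun x hx => by
    rw [Function.mem_support, Set.indicator_of_mem hx]
    exact pow_ne_zero 2 (profile_pos hx).ne'
  refine ((isOpen_openCone e 0).measure_pos volume ⟨e, ?_⟩).trans_le (measure_mono hsub)
  rw [mem_openCone_zero, real_inner_self_eq_norm_sq, he]
  norm_num

/-- The defect of the truncations in the Hardy quotient has a negative limit. -/
theorem tendsto_integral_defect (hN : 1 ≤ N) (he : ‖e‖ = 1) (hk : 0 < k) :
    Tendsto (fun j : ℕ => ∫ x, (openCone e 0).indicator (fun x => profile e k x ^ 2) x *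
      (cutoffSlope k j (halfSpaceDefining e x) ^ 2 -
        (k ^ 2 + k) * Real.smoothTransition (j * halfSpaceDefining e x - 1) ^ 2)) atTop
      (𝓝 (∫ x, (openCone e 0).indicator (fun x => profile e k x ^ 2) x * (-k))) := by
  obtain ⟨C, hC0, hC⟩ := Real.smoothTransition.exists_deriv_bound
  have hqm := (contDiff_halfSpaceDefining (n := 0) e).continuous
  have him := ((measurable_profile e k).pow_const 2).indicator (isOpen_openCone e 0).measurableSet
  refine tendsto_integral_of_dominated_convergence
    (fun x => (openCone e 0).indicator (fun x => profile e k x ^ 2) x *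
      ((k + C) ^ 2 + (k ^ 2 + k)))
    (fun n => ?_) ((integrable_profile_sq hN he hk).mul_const _) (fun n => ae_of_all _ fun x => ?_)
    (ae_of_all _ fun x => ?_)
  · have hτ : Continuous fun x : E => Real.smoothTransition (n * halfSpaceDefining e x - 1) :=
      Real.smoothTransition.continuous.comp (by fun_prop)
    have hτ' : Continuous fun x : E =>
        deriv Real.smoothTransition (n * halfSpaceDefining e x - 1) :=
      Real.smoothTransition.continuous_deriv.comp (by fun_prop)
    refine him.aestronglyMeasurable.mul (Continuous.aestronglyMeasurable ?_)
    unfold cutoffSlope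
    fun_prop
  · have h0 : 0 ≤ (openCone e 0).indicator (fun x => profile e k x ^ 2) x :=
      Set.indicator_nonneg (fun x _ => sq_nonneg _) x
    rw [norm_mul, Real.norm_of_nonneg h0]
    refine mul_le_mul_of_nonneg_left ?_ h0
    have hτ0 := Real.smoothTransition.nonneg (n * halfSpaceDefining e x - 1)
    have hτ1 := Real.smoothTransition.le_one (n * halfSpaceDefining e x - 1)
    have hs : |cutoffSlope k n (halfSpaceDefining e x)| ≤ k + C := by
      refine (abs_add_le _ _).trans (add_le_add ?_ ?_)
      · rw [abs_mul, abs_of_pos hk, abs_of_nonneg hτ0]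
        nlinarith
      -- Here `z + 1` is `n q`.
      · simpa using hC (n * halfSpaceDefining e x - 1)
    refine (norm_sub_le _ _).trans (add_le_add ?_ ?_)
    · rw [Real.norm_of_nonneg (sq_nonneg _), ← sq_abs]
      exact pow_le_pow_left₀ (abs_nonneg _) hs 2
    · rw [Real.norm_of_nonneg (by positivity)]
      exact mul_le_of_le_one_right (by positivity) (pow_le_one₀ hτ0 hτ1)
  · by_cases hx : x ∈ openCone e 0
    · refine tendsto_const_nhds.congr' ?_
      have hq := halfSpaceDefining_pos hx
      have hlim : Tendsto (fun n : ℕ => (n : ℝ) * halfSpaceDefining e x) atTop atTop :=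
        tendsto_natCast_atTop_atTop.atTop_mul_const hq
      -- Once `n q > 2` the cutoff is locally `1`, the slope is `k`, and the bracket is `k² - (k² +
      -- k) = -k`.
      filter_upwards [hlim.eventually_gt_atTop 2] with n hn
      have h1 : Real.smoothTransition (n * halfSpaceDefining e x - 1) = 1 :=
        Real.smoothTransition.one_of_one_le (by linarith)
      have h2 : deriv Real.smoothTransition (n * halfSpaceDefining e x - 1) = 0 :=
        Real.smoothTransition.deriv_eq_zero fun h => by linarith [h.2]
      rw [cutoffSlope, h1, h2]
      ring
    · simp [Set.indicator_of_notMem hx]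

/-- The Hardy constant of a half-space cannot be improved beyond `N ^ 2 / 4`. -/
theorem exists_near_optimal (hN : 1 ≤ N) (he : ‖e‖ = 1) (hk : 0 < k) :
    ∃ φ : E → ℝ, ContDiff ℝ (⊤ : ℕ∞) φ ∧ HasCompactSupport φ ∧ tsupport φ ⊆ openCone e 0 ∧
      0 < ∫ x, φ x ^ 2 / ‖x‖ ^ 2 ∧
      ∫ x, ‖∇ φ x‖ ^ 2 ≤
        ((N : ℝ) ^ 2 / 4 + N * k + k ^ 2) * ∫ x, φ x ^ 2 / ‖x‖ ^ 2 := by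
  have hneg : ∫ x, (openCone e 0).indicator (fun x => profile e k x ^ 2) x * (-k) < 0 := by
    rw [integral_mul_const]
    nlinarith [integral_profile_sq_pos hN he hk]
  obtain ⟨n, hn, hn0⟩ := (((tendsto_integral_defect hN he hk).eventually_lt_const hneg).and
    (eventually_gt_atTop 0)).exists
  have hj : (0 : ℝ) < n := by exact_mod_cast hn0
  have hφ : ContDiff ℝ (⊤ : ℕ∞) (truncation e k n) := contDiff_truncation hj
  have hφ1 : ContDiff ℝ 1 (truncation e k n) := hφ.of_le (by exact_mod_cast le_top)
  have hc : HasCompactSupport (truncation e k n) := hasCompactSupport_truncation he hj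
  have hs : tsupport (truncation e k n) ⊆ openCone e 0 := tsupport_truncation_subset hj
  obtain ⟨-, hV, hS, hid⟩ := integral_norm_gradient_sq (a := 1 + k) he hφ1 hc hs
  have hi := integrable_sq_div_norm_sq hφ1.continuous hc
    (fun h => ne_zero_of_mem_openCone (hs h) rfl)
  have hlt : ∫ x, ‖∇ (truncation e k n) x‖ ^ 2 <
      ((N : ℝ) ^ 2 / 4 + N * k + k ^ 2) * ∫ x, truncation e k n x ^ 2 / ‖x‖ ^ 2 := by
    have hd : Integrable fun x => (openCone e 0).indicator (fun x => profile e k x ^ 2) x *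
      (cutoffSlope k n (halfSpaceDefining e x) ^ 2 -
        (k ^ 2 + k) * Real.smoothTransition (n * halfSpaceDefining e x - 1) ^ 2) := by
      -- The integral of a non-integrable function is `0` by convention, while this one is negative.
      by_contra h
      rw [integral_undef h] at hn
      exact lt_irrefl _ hn
    have hle := integral_mono (hV.add hS)
      ((hi.const_mul ((N : ℝ) ^ 2 / 4 + N * k + k ^ 2)).add hd) (fun x => ?_)
    · have e1 := integral_add hV hS
      have e2 := integral_add (hi.const_mul ((N : ℝ) ^ 2 / 4 + N * k + k ^ 2)) hd
      rw [integral_const_mul] at e2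
      have hle' := e1.symm.le.trans (hle.trans e2.le)
      linarith
    · simp only [Pi.add_apply]
      by_cases hx : x ∈ openCone e 0
      · rw [Set.indicator_of_mem hx]
        exact truncation_inequality he hx
      · have hx' : x ∉ tsupport (truncation e k n) := fun h => hx (hs h)
        have hg : ∇ (truncation e k n) x = 0 := by
          by_contra h
          exact hx' (support_gradient_subset _ h)
        rw [Set.indicator_of_notMem hx, image_eq_zero_of_notMem_tsupport hx', hg]
        simp
  refine ⟨truncation e k n, hφ, hc, hs, ?_, hlt.le⟩
  -- The strict inequality makes the weighted integral positive, so the trial function is nonzero.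
  have h0 : 0 ≤ ∫ x, ‖∇ (truncation e k n) x‖ ^ 2 := integral_nonneg fun x => by positivity
  have hcoef : (0 : ℝ) < (N : ℝ) ^ 2 / 4 + N * k + k ^ 2 := by positivity
  exact (pos_iff_pos_of_mul_pos (h0.trans_lt hlt)).1 hcoef

end NearOptimal

/-! ### Limit of the cone constants -/

section ConeLimit

variable {N : ℕ}

local notation "E" => EuclideanSpace ℝ (Fin N)

theorem zero_notMem_cone (N : ℕ) (γ : ℝ) : (0 : EuclideanSpace ℝ (Fin N)) ∉ cone N γ := fun h => h.1 rfl

theorem ofReal_le_hardyConstant_cone (hN : 1 ≤ N) {γ ε : ℝ} (hγ : γ ≤ Real.pi) (hε : 0 ≤ ε)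
    (hε1 : ε ≤ 1 / 2) (hγε : -ε ≤ Real.cos γ) :
    ENNReal.ofReal ((N : ℝ) ^ 2 / 4 - 3 * (N : ℝ) ^ 2 * ε) ≤ hardyConstant (cone N γ) := by
  rcases le_or_gt ((N : ℝ) ^ 2 / 4 - 3 * (N : ℝ) ^ 2 * ε) 0 with h | h
  · rw [ENNReal.ofReal_of_nonpos h]
    exact zero_le
  · refine le_hardyConstant (by simpa using h) ENNReal.ofReal_ne_top (zero_notMem_cone N γ)
      fun φ => ?_
    rw [setLIntegral_testFunction_sq_div (zero_notMem_cone N γ),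
      setLIntegral_testFunction_gradient_sq, ← ENNReal.ofReal_mul h.le]
    exact ENNReal.ofReal_le_ofReal (hardy_inequality_openCone hN (norm_lastAxis hN) hε hε1
      φ.contDiff_one φ.hasCompactSupport
      (φ.tsupport_subset.trans (cone_subset_openCone hN hγ hγε)))

/-- The angle is continuous on `K` and below `π / 2` there; compactness makes the margin uniform. -/
theorem eventually_subset_cone (hN : 1 ≤ N) {K : Set E} (hK : IsCompact K)
    (hs : K ⊆ openCone (lastAxis N) 0) : ∀ᶠ γ in 𝓝 (Real.pi / 2), K ⊆ cone N γ := by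
  have h : ∀ᶠ γ in 𝓝 (Real.pi / 2), ∀ x ∈ K,
      InnerProductGeometry.angle x (lastAxis N) < γ := by
    refine hK.eventually_forall_of_forall_eventually fun x hx => ?_
    have hx' := (mem_cone_half_pi hN).2 (mem_openCone_zero.1 (hs hx))
    have he : lastAxis N ≠ 0 := fun h => by simpa [h] using norm_lastAxis hN
    have hc : ContinuousAt (fun z : ℝ × E => InnerProductGeometry.angle z.2 (lastAxis N))
        (Real.pi / 2, x) :=
      ContinuousAt.comp (f := fun z : ℝ × E => (z.2, lastAxis N))
        (g := fun p : E × E => InnerProductGeometry.angle p.1 p.2)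
        (InnerProductGeometry.continuousAt_angle (x := (x, lastAxis N)) hx'.1 he) (by fun_prop)
    exact hc.eventually_lt continuousAt_fst hx'.2
  filter_upwards [h] with γ hγ x hx
  exact ⟨ne_zero_of_mem_openCone (hs hx), hγ x hx⟩

theorem eventually_hardyConstant_cone_le (hN : 1 ≤ N) {k : ℝ} (hk : 0 < k) :
    ∀ᶠ γ in 𝓝 (Real.pi / 2),
      hardyConstant (cone N γ) ≤ ENNReal.ofReal ((N : ℝ) ^ 2 / 4 + N * k + k ^ 2) := by
  obtain ⟨φ, hφ, hc, hs, hpos, hle⟩ := exists_near_optimal hN (norm_lastAxis hN) hk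
  filter_upwards [eventually_subset_cone hN hc hs] with γ hγ
  exact hardyConstant_le_of_testFunction (zero_notMem_cone N γ) ⟨φ, hφ, hc, hγ⟩ hpos hle

theorem tendsto_hardyConstant_cone (hN : 1 ≤ N) :
    Tendsto (fun γ : ℝ => hardyConstant (cone N γ)) (𝓝 (Real.pi / 2))
      (𝓝 (ENNReal.ofReal ((N : ℝ) ^ 2 / 4))) := by
  refine tendsto_order.2 ⟨fun a ha => ?_, fun b hb => ?_⟩
  -- The least nonnegative `ε` with `-ε ≤ cos γ`; it is `0` for `γ` just below `π / 2`.
  · have hε : Tendsto (fun γ => max 0 (-Real.cos γ)) (𝓝 (Real.pi / 2)) (𝓝 0) := by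
      have : Continuous fun γ => max 0 (-Real.cos γ) := by fun_prop
      simpa using this.tendsto (Real.pi / 2)
    have hlim : Tendsto (fun γ => ENNReal.ofReal
        ((N : ℝ) ^ 2 / 4 - 3 * (N : ℝ) ^ 2 * max 0 (-Real.cos γ))) (𝓝 (Real.pi / 2))
        (𝓝 (ENNReal.ofReal ((N : ℝ) ^ 2 / 4))) := by
      refine ENNReal.tendsto_ofReal ?_
      simpa using tendsto_const_nhds.sub (hε.const_mul (3 * (N : ℝ) ^ 2))
    filter_upwards [hlim.eventually_const_lt ha,
      hε.eventually_le_const (by norm_num : (0 : ℝ) < 1 / 2),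
      eventually_le_nhds (by linarith [Real.pi_pos] : Real.pi / 2 < Real.pi)] with γ h1 h2 h3
    exact h1.trans_le (ofReal_le_hardyConstant_cone hN h3 (le_max_left _ _) h2
      (by linarith [le_max_right 0 (-Real.cos γ)]))
  · have hlim : Tendsto (fun k : ℝ => ENNReal.ofReal ((N : ℝ) ^ 2 / 4 + N * k + k ^ 2)) (𝓝[>] 0)
        (𝓝 (ENNReal.ofReal ((N : ℝ) ^ 2 / 4))) := by
      refine ENNReal.tendsto_ofReal (Tendsto.mono_left ?_ nhdsWithin_le_nhds)
      have : Continuous fun k : ℝ => (N : ℝ) ^ 2 / 4 + N * k + k ^ 2 := by fun_prop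
      simpa using this.tendsto 0
    obtain ⟨k, hkb, hk⟩ := ((hlim.eventually_lt_const hb).and self_mem_nhdsWithin).exists
    filter_upwards [eventually_hardyConstant_cone_le hN hk] with γ hγ
    exact hγ.trans_lt hkb

end ConeLimit

theorem corollary3p2 (N : ℕ) (hN : 3 ≤ N) :
    Tendsto (fun γ : ℝ => hardyConstant (cone N γ)) (𝓝[≠] (Real.pi / 2))
      (𝓝 (hardyConstant (cone N (Real.pi / 2)))) ∧
    hardyConstant (cone N (Real.pi / 2)) = (N : ℝ≥0∞) ^ 2 / 4 := by
  have h := tendsto_hardyConstant_cone (N := N) (by omega)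
  -- The limit is along the full neighbourhood filter, centre included, so it determines the value
  -- at `π / 2`.
  have hval := eq_of_tendsto_nhds h
  refine ⟨hval ▸ h.mono_left nhdsWithin_le_nhds, ?_⟩
  rw [hval, ENNReal.ofReal_div_of_pos (by norm_num), ENNReal.ofReal_pow (by positivity)]
  simp
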